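/- **Setting.** Let $d\ge 1$, let $\|\cdot\|$ be an arbitrary norm on $\mathbb R^d$, let $\lambda^d$ be Lebesgue measure (equivalently: a $d$-dimensional real normed space with a Haar measure), and let $r>0$. Let $P$ be a Borel probability on $\mathbb R^d$ with Borel density $h$ with respect to $\lambda^d$, such that $\int\|x\|^{r+\delta}\,dP(x)<\infty$ for some $\delta>0$ and such that $h$ is bounded away from $0$ on compact sets: for every $\rho>0$ there is $c_\rho>0$ with $h(x)\ge c_\rho$ whenever $\|x\|\le\rho$. For finite $\alpha\subset\mathbb R^d$ write $d(x,\alpha)=\min_{b\in\alpha}\|x-b\|$ (with $d(x,\emptyset)=+\infty$), and for $a\in\alpha$ $$W(a|\alpha)=\{x:\|x-a\|=d(x,\alpha)\},\qquad W_0(a|\alpha)=\{x:\|x-a\|<d(x,\alpha\setminus\{a\})\}.$$ A finite set $\alpha$ is $n$-optimal if $\operatorname{card}\alpha\le n$ and $\int d(x,\alpha)^r\,dP(x)=\inf\{\int d(x,\beta)^r\,dP(x):\operatorname{card}\beta\le n\}$. For a set $A$ let $\|h\|_A$ and $\operatorname{essinf}h_{|A}$ be the $\lambda^d$-essential supremum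 (in $[0,\infty]$) and essential infimum of $h$ on $A$. For $K$ compact let $K_\varepsilon=\{y:d(y,K)\le\varepsilon\}$ and, for a sequence $(\alpha_n)$ of finite sets, $\alpha_n(K)=\{a\in\alpha_n: W(a|\alpha_n)\cap K\ne\emptyset\}$. **Theorem 4.9.** Let $c>0$. There are constants $c_{22},c_{23},c_{24},c_{25}>0$ such that the following holds for every sequence $(\alpha_n)_{n\ge1}$ of $n$-optimal sets satisfying the sharpened micro-macro inequality with constant $c$, i.e. $$\forall K\subset\mathbb R^d\text{ compact }\ \exists n_K\ \forall n\ge n_K\ \forall x\in K:\quad d(x,\alpha_n)\le c\,n^{-1/d}\,h(x)^{-\frac1{r+d}} .$$ For every nonempty compact $K\subset\mathbb R^d$, $$\limsup_{n\to\infty}\ n\max_{a\in\alpha_n(K)}P(W(a|\alpha_n))\le c_{22}\Big(\inf_{\varepsilon>0}\|h\|_{K_\varepsilon}\Big)^{\frac r{r+d}},$$ $$\limsup_{n\to\infty}\ n^{1+\frac rd}\max_{a\in\alpha_n(K)}\int_{W(a|\alpha_n)}\|x-a\|^r\,dP(x)\le c_{23}\Big(1+\log\Big(\inf_{\varepsilon>0}\frac{\|h\|_{K_\varepsilon}}{\operatorname{essinf}h_{|K_\varepsilon}}\Big)\Big),$$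 $$\liminf_{n\to\infty}\ n\min_{a\in\alpha_n(K)}P(W_0(a|\alpha_n))\ge c_{24}\sup_{\varepsilon>0}\big(\operatorname{essinf}h_{|K_\varepsilon}\big)^{\frac r{r+d}},$$ $$\liminf_{n\to\infty}\ n^{1+\frac rd}\min_{a\in\alpha_n(K)}\int_{W(a|\alpha_n)}\|x-a\|^r\,dP(x)\ge c_{25}\sup_{\varepsilon>0}\Big(\frac{\operatorname{essinf}h_{|K_\varepsilon}}{\|h\|_{K_\varepsilon}}\Big)^{\max(1,r)} .$$ (If $\|h\|_{K_\varepsilon}=\infty$, the ratios are read as $\infty$ and $0$, and $\log\infty=\infty$.) -/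

import Mathlib

open MeasureTheory Filter
open scoped ENNReal

namespace Quantization

section Codebooks

variable {E : Type*} [NormedAddCommGroup E]

/-- The Voronoi cell `W(a | s)`: the points `x` with `‖x - a‖ = min_{b ∈ s} ‖x - b‖`. -/
def cell (a : E) (s : Finset E) : Set E :=
  {x | edist x a = Metric.infEDist x (s : Set E)}

/-- The open Voronoi cell `W₀(a | s)`: the points `x` with `‖x - a‖ < d(x, s \ {a})`
(the distance to the empty set is infinite). -/
def openCell (a : E) (s : Finset E) : Set E :=
  {x | edist x a < Metric.infEDist x ((s : Set E) \ {a})}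

/-- `s(K)`: the points of the codebook `s` whose Voronoi cell meets `K`. -/
def meeting (s : Finset E) (K : Set E) : Set E :=
  {a | a ∈ s ∧ (cell a s ∩ K).Nonempty}

variable [MeasurableSpace E]

/-- The distortion `∫ d(x, s)^r dP(x)` of a codebook `s`; it is infinite when `s` is empty. -/
noncomputable def distortion (P : Measure E) (r : ℝ) (s : Finset E) : ℝ≥0∞ :=
  ∫⁻ x, Metric.infEDist x (s : Set E) ^ r ∂P

/-- The `r`-th power `e_{n,r}^r` of the `n`-th level quantization error:
the infimum of the distortion over all codebooks with at most `n` points. -/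
noncomputable def errorPow (P : Measure E) (r : ℝ) (n : ℕ) : ℝ≥0∞ :=
  ⨅ (s : Finset E) (_ : s.card ≤ n), distortion P r s

/-- `s` is an `n`-optimal codebook of order `r` for `P`. -/
def IsOptimal (P : Measure E) (r : ℝ) (n : ℕ) (s : Finset E) : Prop :=
  s.card ≤ n ∧ distortion P r s = errorPow P r n

/-- The local inertia `∫_{W(a | s)} ‖x - a‖^r dP(x)`. -/
noncomputable def localInertia (P : Measure E) (r : ℝ) (a : E) (s : Finset E) : ℝ≥0∞ :=
  ∫⁻ x in cell a s, edist x a ^ r ∂P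

/-- The essential supremum of `h` on `A` with respect to `μ`, with values in `[0, ∞]`. -/
noncomputable def essSupOn (μ : Measure E) (h : E → ℝ) (A : Set E) : ℝ≥0∞ :=
  essSup (fun x => ENNReal.ofReal (h x)) (μ.restrict A)

/-- The essential infimum of `h` on `A` with respect to `μ`, with values in `[0, ∞]`. -/
noncomputable def essInfOn (μ : Measure E) (h : E → ℝ) (A : Set E) : ℝ≥0∞ :=
  essInf (fun x => ENNReal.ofReal (h x)) (μ.restrict A)

/-- The sharpened micro-macro inequality with constant `c` in dimension `d`:
for every compact `K` and all large `n`, `d(x, α n) ≤ c n^{-1/d} h(x)^{-1/(r+d)}` on `K`. -/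
def SharpMicroMacro (d : ℕ) (r c : ℝ) (h : E → ℝ) (α : ℕ → Finset E) : Prop :=
  ∀ K : Set E, IsCompact K → ∃ N : ℕ, ∀ n ≥ N, ∀ x ∈ K,
    Metric.infDist x (α n : Set E) ≤
      c * (n : ℝ) ^ (-(1 / (d : ℝ))) * h x ^ (-(1 / (r + d)))

end Codebooks

end Quantization

/-! Write `q = r + d`, `τ = c n^{-1/d}`, and let `m`, `M` be the essential bounds of `h` on `K_ε`.
For large `n` every cell meeting `K` lies in `K_ε`, so each estimate concerns one cell.

Upper bounds. On `W(a|α_n)` the distance to the codebook is `‖x - a‖`, so the micro-macro inequality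
inverts to `h(x) ≤ τ^q ‖x - a‖^{-q}`. This holds together with `h ≤ M`, and the two bounds cross at
radius `τ M^{-1/q}`. In polar coordinates the tail of `‖x‖^{-q}` converges and gives mass of order
`τ^d M^{r/q}`. For the inertia the tail becomes `‖x‖^{-d}`, which diverges logarithmically. The cell
radius `τ m^{-1/q}` cuts it off, and this produces `log (M/m)`.

Lower bounds. Delete `a` from an optimal codebook and insert a better point. The result cannot beat
the optimum. Insertion gains at least `C n^{-(1+r/d)}`, because `n` small balls leave a hole in the
unit ball, wherever `K` may be. Deletion costs at most `(4ρ)^r P(W_0(a|α_n))` with `ρ = τ m^{-1/q}`,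
because another codebook point lies within `3ρ` of `a`. Comparing the two bounds the mass from
below. Since `h ≤ M`, half of that mass lies outside a ball of comparable volume, which bounds the
inertia.

The key lemmas are `setLIntegral_density_le`, `setLIntegral_density_mul_edist_rpow_le`,
`exists_forall_meeting_bounds`, `le_natCast_mul_measure_openCell` and
`le_natCast_rpow_mul_localInertia`. -/

namespace Quantization

/-! ### Radial power integrals -/

section PowerTails

variable {E : Type*} [NormedAddCommGroup E] [NormedSpace ℝ E] [FiniteDimensional ℝ E] [Nontrivial E]
  [MeasurableSpace E] [BorelSpace E] (μ : Measure E) [μ.IsAddHaarMeasure]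

lemma lintegral_ofReal_fun_norm {f : ℝ → ℝ} (hf : ∀ y, 0 ≤ f y)
    (hi : IntegrableOn (fun y : ℝ => y ^ (Module.finrank ℝ E - 1) • f y) (Set.Ioi 0)) :
    ∫⁻ x, ENNReal.ofReal (f ‖x‖) ∂μ = ENNReal.ofReal (Module.finrank ℝ E *
      (μ.real (Metric.ball 0 1) *
        ∫ y in Set.Ioi (0 : ℝ), y ^ (Module.finrank ℝ E - 1) • f y)) := by
  rw [← ofReal_integral_eq_lintegral_ofReal ((integrable_fun_norm_addHaar μ).2 hi)
    (ae_of_all _ fun x => hf _), integral_fun_norm_addHaar]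
  simp [nsmul_eq_mul]

lemma lintegral_norm_gt_rpow {d : ℕ} (hd : Module.finrank ℝ E = d) {r R : ℝ} (hr : 0 < r)
    (hR : 0 < R) :
    ∫⁻ x in {x : E | R < ‖x‖}, ENNReal.ofReal (‖x‖ ^ (-(r + d))) ∂μ =
      ENNReal.ofReal (μ.real (Metric.ball 0 1) * (d / r) * R ^ (-r)) := by
  have hd1 : 1 ≤ d := hd ▸ Module.finrank_pos
  have key : ∀ y ∈ Set.Ioi (0 : ℝ), y ^ (Module.finrank ℝ E - 1) •
      (Set.Ioi R).indicator (fun y : ℝ => y ^ (-(r + d))) y =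
      (Set.Ioi R).indicator (fun y : ℝ => y ^ (-r - 1)) y := by
    intro y hy
    by_cases h : y ∈ Set.Ioi R
    · have hy0 : 0 < y := hy
      rw [Set.indicator_of_mem h, Set.indicator_of_mem h, hd, smul_eq_mul, ← Real.rpow_natCast,
        ← Real.rpow_add hy0]
      congr 1
      push_cast [hd1]
      ring
    · simp [Set.indicator_of_notMem h]
  have hint : IntegrableOn (fun y : ℝ => y ^ (-r - 1)) (Set.Ioi R) :=
    integrableOn_Ioi_rpow_of_lt (by linarith) hR
  have hsub : Set.Ioi (0 : ℝ) ∩ Set.Ioi R = Set.Ioi R :=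
    Set.inter_eq_right.2 fun y hy => hR.trans hy
  have hmeas : MeasurableSet {x : E | R < ‖x‖} := measurableSet_lt measurable_const measurable_norm
  have hf : ∀ y, 0 ≤ (Set.Ioi R).indicator (fun y : ℝ => y ^ (-(r + d))) y :=
    Set.indicator_nonneg fun y hy => Real.rpow_nonneg (hR.trans hy).le _
  have h1 := lintegral_ofReal_fun_norm μ (E := E) hf (by
    rw [integrableOn_congr_fun key measurableSet_Ioi]
    exact (integrable_indicator_iff measurableSet_Ioi).2 hint |>.integrableOn)
  rw [← lintegral_indicator hmeas]
  convert h1 using 2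
  · ext x
    by_cases h : R < ‖x‖
    · rw [Set.indicator_of_mem (by exact h), Set.indicator_of_mem (by exact h)]
    · rw [Set.indicator_of_notMem (by exact h), Set.indicator_of_notMem (by exact h)]; simp
  · rw [setIntegral_congr_fun measurableSet_Ioi key, setIntegral_indicator measurableSet_Ioi, hsub,
      integral_Ioi_rpow_of_lt (by linarith) hR, hd]
    have : -r - 1 + 1 = -r := by ring
    rw [this]
    field_simp

/-- At the critical exponent `-d` the radial integrand is `1/y`; this is the source of the logarithm
in the inertia bound. -/
lemma lintegral_norm_mem_Ioc_rpow {d : ℕ} (hd : Module.finrank ℝ E = d) {R S : ℝ}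
    (hR : 0 < R) (hRS : R ≤ S) :
    ∫⁻ x in {x : E | ‖x‖ ∈ Set.Ioc R S}, ENNReal.ofReal (‖x‖ ^ (-(d : ℝ))) ∂μ =
      ENNReal.ofReal (μ.real (Metric.ball 0 1) * d * Real.log (S / R)) := by
  have hd1 : 1 ≤ d := hd ▸ Module.finrank_pos
  have key : ∀ y ∈ Set.Ioi (0 : ℝ), y ^ (Module.finrank ℝ E - 1) •
      (Set.Ioc R S).indicator (fun y : ℝ => y ^ (-(d : ℝ))) y =
      (Set.Ioc R S).indicator (fun y : ℝ => y⁻¹) y := by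
    intro y hy
    by_cases h : y ∈ Set.Ioc R S
    · have hy0 : 0 < y := hy
      rw [Set.indicator_of_mem h, Set.indicator_of_mem h, hd, smul_eq_mul, ← Real.rpow_natCast,
        ← Real.rpow_add hy0, ← Real.rpow_neg_one]
      congr 1
      push_cast [hd1]
      ring
    · simp [Set.indicator_of_notMem h]
  have h0 : (0 : ℝ) ∉ Set.uIcc R S := by
    rw [Set.uIcc_of_le hRS]
    exact fun h => hR.not_ge h.1
  have hint : IntegrableOn (fun y : ℝ => y⁻¹) (Set.Ioc R S) :=
    (intervalIntegrable_iff_integrableOn_Ioc_of_le hRS).1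
      (intervalIntegral.intervalIntegrable_inv (fun x hx h => h0 (h ▸ hx)) continuousOn_id)
  have hsub : Set.Ioi (0 : ℝ) ∩ Set.Ioc R S = Set.Ioc R S :=
    Set.inter_eq_right.2 fun y hy => hR.trans hy.1
  have hmeas : MeasurableSet {x : E | ‖x‖ ∈ Set.Ioc R S} := measurable_norm measurableSet_Ioc
  have hf : ∀ y, 0 ≤ (Set.Ioc R S).indicator (fun y : ℝ => y ^ (-(d : ℝ))) y :=
    Set.indicator_nonneg fun y hy => Real.rpow_nonneg (hR.trans hy.1).le _
  have h1 := lintegral_ofReal_fun_norm μ (E := E) hf (by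
    rw [integrableOn_congr_fun key measurableSet_Ioi]
    exact (integrable_indicator_iff measurableSet_Ioc).2 hint |>.integrableOn)
  rw [← lintegral_indicator hmeas]
  convert h1 using 2
  · ext x
    by_cases h : ‖x‖ ∈ Set.Ioc R S
    · rw [Set.indicator_of_mem (by exact h), Set.indicator_of_mem (by exact h)]
    · rw [Set.indicator_of_notMem (by exact h), Set.indicator_of_notMem (by exact h)]; simp
  · rw [setIntegral_congr_fun measurableSet_Ioi key, setIntegral_indicator measurableSet_Ioc, hsub,
      ← intervalIntegral.integral_of_le hRS, integral_inv h0, hd]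
    ring

end PowerTails

/-! ### Mass and inertia of a set under pointwise density bounds -/

lemma edist_rpow_eq_ofReal {E : Type*} [SeminormedAddCommGroup E] {r : ℝ} (x a : E) (hr : 0 < r) :
    edist x a ^ r = ENNReal.ofReal (‖x - a‖ ^ r) := by
  rw [edist_dist, dist_eq_norm, ENNReal.ofReal_rpow_of_nonneg (norm_nonneg _) hr.le]

/-- Split `W` at radius `R` around `a`, enlarge the inner part to the whole ball, and translate the
outer part to the origin, where radial integrals apply. -/
lemma setLIntegral_le_closedBall_add {E : Type*} [NormedAddCommGroup E] [MeasurableSpace E]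
    [BorelSpace E] (μ : Measure E) [μ.IsAddRightInvariant] {W : Set E}
    (hW : MeasurableSet W) {f g k : E → ℝ≥0∞}
    (a : E) (R : ℝ) (h1 : ∀ᵐ x ∂μ.restrict W, x ∈ Metric.closedBall a R → f x ≤ g x)
    {T : Set E} (hT : ∀ x ∈ W, R < ‖x - a‖ → x - a ∈ T ∧ f x ≤ k (x - a))
    (hTm : MeasurableSet T) :
    ∫⁻ x in W, f x ∂μ ≤ (∫⁻ x in Metric.closedBall a R, g x ∂μ) + ∫⁻ x in T, k x ∂μ := by
  have hB : MeasurableSet (Metric.closedBall a R) := measurableSet_closedBall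
  rw [← lintegral_inter_add_sdiff _ W hB]
  refine add_le_add ?_ ?_
  · calc ∫⁻ x in W ∩ Metric.closedBall a R, f x ∂μ
        ≤ ∫⁻ x in W ∩ Metric.closedBall a R, g x ∂μ := by
          refine lintegral_mono_ae ?_
          rw [ae_restrict_iff' hW] at h1
          refine (ae_restrict_iff' (hW.inter hB)).2 ?_
          filter_upwards [h1] with x hx hx'
          exact hx hx'.1 hx'.2
      _ ≤ _ := lintegral_mono_set Set.inter_subset_right
  · calc ∫⁻ x in W \ Metric.closedBall a R, f x ∂μ
        ≤ ∫⁻ x, T.indicator k (x - a) ∂μ := by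
          rw [← lintegral_indicator (hW.diff hB)]
          refine lintegral_mono fun x => ?_
          refine Set.indicator_apply_le' (fun hx => ?_) (fun _ => bot_le)
          have := hT x hx.1 (by simpa [dist_eq_norm] using hx.2)
          rw [Set.indicator_of_mem this.1]
          exact this.2
      _ = _ := by
          rw [lintegral_sub_right_eq_self (μ := μ) (T.indicator k) a, lintegral_indicator hTm]

section CellIntegrals

variable {E : Type*} [NormedAddCommGroup E] [NormedSpace ℝ E] [FiniteDimensional ℝ E]
  [MeasurableSpace E] [BorelSpace E] (μ : Measure E) [μ.IsAddHaarMeasure]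

lemma addHaar_closedBall_eq_ofReal {d : ℕ} (hd : Module.finrank ℝ E = d) (a : E) {R : ℝ}
    (hR : 0 ≤ R) :
    μ (Metric.closedBall a R) = ENNReal.ofReal (μ.real (Metric.ball 0 1) * R ^ d) := by
  rw [μ.addHaar_closedBall a hR, hd, mul_comm,
    ENNReal.ofReal_mul measureReal_nonneg, ofReal_measureReal measure_ball_lt_top.ne]

lemma le_rpow_of_le_mul_rpow_neg {t τ y q : ℝ} (hq : 0 < q) (ht : 0 < t) (hτ : 0 < τ) (hy : 0 < y)
    (h : t ≤ τ * y ^ (-(1 / q))) : y ≤ τ ^ q * t ^ (-q) := by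
  have h1 : t ^ q ≤ (τ * y ^ (-(1 / q))) ^ q := Real.rpow_le_rpow ht.le h hq.le
  rw [Real.mul_rpow hτ.le (Real.rpow_nonneg hy.le _), ← Real.rpow_mul hy.le,
    show -(1 / q) * q = -1 by field_simp, Real.rpow_neg_one] at h1
  rw [Real.rpow_neg ht.le, ← div_eq_mul_inv, le_div_iff₀ (Real.rpow_pos_of_pos ht _)]
  rwa [← div_eq_mul_inv, le_div_iff₀ hy, mul_comm] at h1

variable {μ} {d : ℕ} {r τ M : ℝ} {h : E → ℝ} {W : Set E} {a : E}

/-- Under `h ≤ M` the ball of radius `R` holds at most half of the mass `p`; the other half sits at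
distance more than `R` from `a`. -/
lemma le_setLIntegral_density_mul_edist_rpow {p R : ℝ} (hd : Module.finrank ℝ E = d) (hr : 0 < r)
    (hW : MeasurableSet W) (hhM : ∀ᵐ x ∂μ.restrict W, h x ≤ M) (hM : 0 < M) (hR : 0 < R)
    (hp : 0 ≤ p) (hRp : M * (μ.real (Metric.ball 0 1) * R ^ d) ≤ p / 2)
    (hpW : ENNReal.ofReal p ≤ ∫⁻ x in W, ENNReal.ofReal (h x) ∂μ) :
    ENNReal.ofReal (R ^ r * (p / 2)) ≤ ∫⁻ x in W, ENNReal.ofReal (h x) * edist x a ^ r ∂μ := by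
  have hB : MeasurableSet (Metric.closedBall a R) := measurableSet_closedBall
  have h1 : ∫⁻ x in W ∩ Metric.closedBall a R, ENNReal.ofReal (h x) ∂μ ≤ ENNReal.ofReal (p / 2) :=
    calc ∫⁻ x in W ∩ Metric.closedBall a R, ENNReal.ofReal (h x) ∂μ
        ≤ ∫⁻ x in W ∩ Metric.closedBall a R, ENNReal.ofReal M ∂μ := by
          refine lintegral_mono_ae ?_
          rw [ae_restrict_iff' hW] at hhM
          refine (ae_restrict_iff' (hW.inter hB)).2 ?_
          filter_upwards [hhM] with x hx hx'
          exact ENNReal.ofReal_le_ofReal (hx hx'.1)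
      _ ≤ ∫⁻ x in Metric.closedBall a R, ENNReal.ofReal M ∂μ :=
          lintegral_mono_set Set.inter_subset_right
      _ ≤ _ := by
          rw [setLIntegral_const, addHaar_closedBall_eq_ofReal μ hd a hR.le,
            ← ENNReal.ofReal_mul hM.le]
          exact ENNReal.ofReal_le_ofReal hRp
  have h2 : ENNReal.ofReal (p / 2) ≤
      ∫⁻ x in W \ Metric.closedBall a R, ENNReal.ofReal (h x) ∂μ := by
    rw [← lintegral_inter_add_sdiff _ W hB] at hpW
    have hsplit : ENNReal.ofReal p = ENNReal.ofReal (p / 2) + ENNReal.ofReal (p / 2) := by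
      rw [← ENNReal.ofReal_add (by positivity) (by positivity), add_halves]
    rw [hsplit] at hpW
    exact (ENNReal.add_le_add_iff_left ENNReal.ofReal_ne_top).1
      (hpW.trans (add_le_add_left h1 _))
  calc ENNReal.ofReal (R ^ r * (p / 2))
      ≤ ENNReal.ofReal (R ^ r) * ∫⁻ x in W \ Metric.closedBall a R, ENNReal.ofReal (h x) ∂μ := by
        rw [ENNReal.ofReal_mul (by positivity)]
        gcongr
    _ = ∫⁻ x in W \ Metric.closedBall a R, ENNReal.ofReal (R ^ r) * ENNReal.ofReal (h x) ∂μ :=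
        (lintegral_const_mul' _ _ ENNReal.ofReal_ne_top).symm
    _ ≤ ∫⁻ x in W \ Metric.closedBall a R, ENNReal.ofReal (h x) * edist x a ^ r ∂μ := by
        refine setLIntegral_mono' (hW.diff hB) fun x hx => ?_
        have hxR : R < ‖x - a‖ := by simpa [dist_eq_norm] using hx.2
        rw [mul_comm, edist_rpow_eq_ofReal x a hr]
        gcongr
    _ ≤ _ := lintegral_mono_set Set.sdiff_subset

variable [Nontrivial E]

lemma setLIntegral_density_le (hd : Module.finrank ℝ E = d) (hr : 0 < r) (hτ : 0 < τ) (hM : 0 < M)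
    (hW : MeasurableSet W) (hhM : ∀ᵐ x ∂μ.restrict W, h x ≤ M)
    (hh : ∀ x ∈ W, 0 < h x ∧ ‖x - a‖ ≤ τ * h x ^ (-(1 / (r + d)))) :
    ∫⁻ x in W, ENNReal.ofReal (h x) ∂μ ≤
      ENNReal.ofReal (μ.real (Metric.ball 0 1) * (1 + d / r) * τ ^ d * M ^ (r / (r + d))) := by
  have hq : 0 < r + d := by positivity
  set q : ℝ := r + d with hqdef
  -- Crossover radius, where `τ ^ q * R ^ (-q) = M`.
  set R : ℝ := τ * M ^ (-(1 / q)) with hRdef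
  have hR : 0 < R := by positivity
  have hdq : (d : ℝ) = q - r := by rw [hqdef]; ring
  refine (setLIntegral_le_closedBall_add μ hW a R (g := fun _ => ENNReal.ofReal M)
    (T := {x | R < ‖x‖}) (k := fun x => ENNReal.ofReal (τ ^ q) * ENNReal.ofReal (‖x‖ ^ (-q)))
    ?_ ?_ (measurableSet_lt measurable_const measurable_norm)).trans ?_
  · filter_upwards [hhM] with x hx _ using ENNReal.ofReal_le_ofReal hx
  · intro x hx hxR
    refine ⟨hxR, ?_⟩
    rw [← ENNReal.ofReal_mul (by positivity)]
    exact ENNReal.ofReal_le_ofReal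
      (le_rpow_of_le_mul_rpow_neg hq (hR.trans hxR) hτ (hh x hx).1 (hh x hx).2)
  · rw [lintegral_const_mul' _ _ ENNReal.ofReal_ne_top, hqdef, lintegral_norm_gt_rpow μ hd hr hR,
      setLIntegral_const, addHaar_closedBall_eq_ofReal μ hd a hR.le,
      ← ENNReal.ofReal_mul (by positivity), ← ENNReal.ofReal_mul (by positivity),
      ← ENNReal.ofReal_add (by positivity) (by positivity), ← hqdef]
    refine ENNReal.ofReal_le_ofReal (le_of_eq ?_)
    have e1 : M * R ^ d = τ ^ d * M ^ (r / q) := by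
      rw [hRdef, mul_pow, ← Real.rpow_natCast (M ^ _), ← Real.rpow_mul hM.le]
      have : r / q = 1 + -(1 / q) * d := by rw [hdq]; field_simp; ring
      rw [this, Real.rpow_add hM, Real.rpow_one]
      ring
    have e2 : τ ^ q * R ^ (-r) = τ ^ d * M ^ (r / q) := by
      rw [hRdef, Real.mul_rpow hτ.le (by positivity), ← Real.rpow_mul hM.le, ← mul_assoc,
        ← Real.rpow_add hτ, ← Real.rpow_natCast τ d]
      congr 2
      · rw [hdq]; ring
      · field_simp
    linear_combination (μ.real (Metric.ball 0 1)) * e1 + (μ.real (Metric.ball 0 1)) * (d / r) * e2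

lemma setLIntegral_density_mul_edist_rpow_le {m : ℝ} (hd : Module.finrank ℝ E = d) (hr : 0 < r)
    (hτ : 0 < τ) (hm : 0 < m) (hmM : m ≤ M)
    (hW : MeasurableSet W) (hhM : ∀ᵐ x ∂μ.restrict W, h x ≤ M)
    (hh : ∀ x ∈ W, 0 < h x ∧ ‖x - a‖ ≤ τ * h x ^ (-(1 / (r + d))))
    (hhm : ∀ x ∈ W, ‖x - a‖ ≤ τ * m ^ (-(1 / (r + d)))) :
    ∫⁻ x in W, ENNReal.ofReal (h x) * edist x a ^ r ∂μ ≤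
      ENNReal.ofReal (μ.real (Metric.ball 0 1) * τ ^ (r + d) * (1 + Real.log (M / m))) := by
  have hM : 0 < M := hm.trans_le hmM
  have hq : 0 < r + d := by positivity
  set q : ℝ := r + d with hqdef
  set R : ℝ := τ * M ^ (-(1 / q)) with hRdef
  set S : ℝ := τ * m ^ (-(1 / q)) with hSdef
  have hR : 0 < R := by positivity
  have hRS : R ≤ S := by
    refine mul_le_mul_of_nonneg_left ?_ hτ.le
    exact Real.rpow_le_rpow_of_nonpos hm hmM (by simp; positivity)
  have hlog : 0 ≤ Real.log (M / m) := Real.log_nonneg (by rwa [le_div_iff₀ hm, one_mul])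
  have hSR : Real.log (S / R) = 1 / q * Real.log (M / m) := by
    have : S / R = (M / m) ^ (1 / q) := by
      rw [hSdef, hRdef, mul_div_mul_left _ _ hτ.ne', Real.rpow_neg hm.le, Real.rpow_neg hM.le,
        Real.div_rpow hM.le hm.le]
      field_simp
    rw [this, Real.log_rpow (by positivity)]
  refine (setLIntegral_le_closedBall_add μ hW a R (g := fun _ => ENNReal.ofReal (M * R ^ r))
    (T := {x | ‖x‖ ∈ Set.Ioc R S})
    (k := fun x => ENNReal.ofReal (τ ^ q) * ENNReal.ofReal (‖x‖ ^ (-(d : ℝ))))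
    ?_ ?_ (measurable_norm measurableSet_Ioc)).trans ?_
  · filter_upwards [hhM] with x hx hxR
    rw [edist_rpow_eq_ofReal x a hr, ENNReal.ofReal_mul hM.le]
    rw [Metric.mem_closedBall, dist_eq_norm] at hxR
    gcongr
  · intro x hx hxR
    refine ⟨⟨hxR, hhm x hx⟩, ?_⟩
    have hx0 : 0 < ‖x - a‖ := hR.trans hxR
    rw [← ENNReal.ofReal_mul (by positivity), edist_rpow_eq_ofReal x a hr,
      ← ENNReal.ofReal_mul (hh x hx).1.le]
    refine ENNReal.ofReal_le_ofReal ?_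
    calc h x * ‖x - a‖ ^ r ≤ τ ^ q * ‖x - a‖ ^ (-q) * ‖x - a‖ ^ r := by
          gcongr
          exact le_rpow_of_le_mul_rpow_neg hq hx0 hτ (hh x hx).1 (hh x hx).2
      _ = _ := by
          rw [mul_assoc, ← Real.rpow_add hx0]
          congr 2
          rw [hqdef]; ring
  · rw [lintegral_const_mul' _ _ ENNReal.ofReal_ne_top, lintegral_norm_mem_Ioc_rpow μ hd hR hRS,
      setLIntegral_const, addHaar_closedBall_eq_ofReal μ hd a hR.le, hSR,
      ← ENNReal.ofReal_mul (by positivity), ← ENNReal.ofReal_mul (by positivity),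
      ← ENNReal.ofReal_add (by positivity) (by positivity)]
    refine ENNReal.ofReal_le_ofReal ?_
    have e1 : M * R ^ r * R ^ d = τ ^ q := by
      rw [mul_assoc, ← Real.rpow_natCast R d, ← Real.rpow_add hR, ← hqdef, hRdef,
        Real.mul_rpow hτ.le (by positivity), ← Real.rpow_mul hM.le,
        show -(1 / q) * q = -1 by field_simp, Real.rpow_neg_one]
      field_simp
    -- The tail contributes the factor `d / q`; bounding it by `1` gives both terms the same
    -- constant.
    have e2 : (d : ℝ) * (1 / q) ≤ 1 := by
      rw [mul_one_div, div_le_one hq, hqdef]; linarith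
    have e3 : d * (1 / q) * Real.log (M / m) ≤ 1 * Real.log (M / m) := by gcongr
    have e4 : 0 ≤ μ.real (Metric.ball 0 1) * τ ^ q := by positivity
    calc M * R ^ r * (μ.real (Metric.ball 0 1) * R ^ d) +
          τ ^ q * (μ.real (Metric.ball 0 1) * d * (1 / q * Real.log (M / m)))
        = μ.real (Metric.ball 0 1) * τ ^ q * (1 + d * (1 / q) * Real.log (M / m)) := by
          linear_combination (μ.real (Metric.ball 0 1)) * e1
      _ ≤ _ := by gcongr; linarith

end CellIntegrals

/-! ### Geometry of Voronoi cells -/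

section Geometry

variable {E : Type*} [NormedAddCommGroup E]

lemma isClosed_cell (a : E) (s : Finset E) : IsClosed (cell a s) :=
  isClosed_eq (continuous_id.edist continuous_const) Metric.continuous_infEDist

lemma isOpen_openCell (a : E) (s : Finset E) : IsOpen (openCell a s) :=
  isOpen_lt (continuous_id.edist continuous_const) Metric.continuous_infEDist

lemma infEDist_eq_min_sdiff {a : E} {s : Finset E} (ha : a ∈ s) (x : E) :
    Metric.infEDist x (s : Set E) = min (edist x a) (Metric.infEDist x ((s : Set E) \ {a})) := by
  have h : insert a ((s : Set E) \ {a}) = s := by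
    rw [Set.insert_sdiff_singleton, Set.insert_eq_of_mem (by exact_mod_cast ha)]
  conv_lhs => rw [← h, Set.insert_eq, Metric.infEDist_union,
    Metric.infEDist_singleton]

lemma openCell_subset_cell {a : E} {s : Finset E} (ha : a ∈ s) : openCell a s ⊆ cell a s := by
  intro x hx
  rw [cell, Set.mem_ofPred_eq, infEDist_eq_min_sdiff ha, min_eq_left (le_of_lt hx)]

lemma infDist_eq_norm_of_mem_cell {a x : E} {s : Finset E} (hx : x ∈ cell a s) :
    Metric.infDist x (s : Set E) = ‖x - a‖ := by
  rw [Metric.infDist, ← show edist x a = Metric.infEDist x (s : Set E) from hx, edist_dist,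
    dist_eq_norm, ENNReal.toReal_ofReal (norm_nonneg _)]

lemma exists_mem_norm_sub_eq_infDist {s : Finset E} (hs : s.Nonempty) (x : E) :
    ∃ b ∈ s, ‖x - b‖ = Metric.infDist x (s : Set E) := by
  obtain ⟨b, hb, h⟩ := s.finite_toSet.isCompact.exists_infDist_eq_dist
    (Finset.coe_nonempty.2 hs) x
  exact ⟨b, by exact_mod_cast hb, by rw [h, dist_eq_norm]⟩

/-- By continuity of the distance the points violating the bound form an open set; being null, it is
empty. This allows the essential infimum of `h` to replace a pointwise lower bound. -/
lemma infDist_le_of_ae_le [MeasurableSpace E] {μ : Measure E}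
    [μ.IsOpenPosMeasure] {s U : Set E} (hU : IsOpen U) {ρ : ℝ}
    (h : ∀ᵐ x ∂μ, x ∈ U → Metric.infDist x s ≤ ρ) : ∀ x ∈ U, Metric.infDist x s ≤ ρ := by
  have hopen : IsOpen (U ∩ {x | ρ < Metric.infDist x s}) :=
    hU.inter (isOpen_lt continuous_const (Metric.continuous_infDist_pt s))
  have h0 : μ (U ∩ {x | ρ < Metric.infDist x s}) = 0 := by
    rw [ae_iff] at h
    convert h using 2
    ext x
    simp
  rw [hopen.measure_eq_zero_iff μ] at h0
  intro x hx
  by_contra hlt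
  have : x ∈ U ∩ {x | ρ < Metric.infDist x s} := ⟨hx, not_le.1 hlt⟩
  rw [h0] at this
  exact this

variable [NormedSpace ℝ E]

/-- Cells are star-shaped about their centre in any norm: moving from `x` towards `a` shortens `‖x -
a‖` by the full step, while the distance to any other `b` drops by at most that step. -/
lemma segment_mem_cell {a x : E} {s : Finset E} (ha : a ∈ s) (hx : x ∈ cell a s) {t : ℝ}
    (ht0 : 0 ≤ t) (ht1 : t ≤ 1) : a + t • (x - a) ∈ cell a s := by
  have hy : ‖a + t • (x - a) - a‖ = t * ‖x - a‖ := by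
    rw [add_sub_cancel_left, norm_smul, Real.norm_of_nonneg ht0]
  have hxy : ‖x - (a + t • (x - a))‖ = (1 - t) * ‖x - a‖ := by
    rw [show x - (a + t • (x - a)) = (1 - t) • (x - a) by module, norm_smul,
      Real.norm_of_nonneg (by linarith)]
  refine le_antisymm ?_ (Metric.infEDist_le_edist_of_mem (by exact_mod_cast ha))
  refine Metric.le_infEDist.2 fun b hb => ?_
  rw [edist_dist, edist_dist, dist_eq_norm, dist_eq_norm]
  refine ENNReal.ofReal_le_ofReal ?_
  have h1 : ‖x - a‖ ≤ ‖x - b‖ := by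
    rw [← infDist_eq_norm_of_mem_cell hx, ← dist_eq_norm]
    exact Metric.infDist_le_dist_of_mem hb
  have h2 : ‖x - b‖ ≤ ‖x - (a + t • (x - a))‖ + ‖a + t • (x - a) - b‖ := by
    simpa using norm_add_le (x - (a + t • (x - a))) (a + t • (x - a) - b)
  rw [hy]
  linarith

/-- If a codebook is fine near `K` compared with `ε`, the cells meeting `K` stay near `K`. -/
lemma cell_subset_ball {s : Finset E} {K : Set E} {ε σ : ℝ} (hσ : σ < ε / 4)
    (hs : ∀ x ∈ Metric.cthickening ε K, Metric.infDist x (s : Set E) ≤ σ)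
    {a : E} (ha : a ∈ meeting s K) (hε : 0 < ε) :
    ∃ x₀ ∈ K, ‖a - x₀‖ ≤ σ ∧ cell a s ⊆ Metric.ball a (ε / 4) := by
  obtain ⟨has, x₀, hx₀, hx₀K⟩ := ha
  have h0 : ‖a - x₀‖ ≤ σ := by
    rw [norm_sub_rev, ← infDist_eq_norm_of_mem_cell hx₀]
    exact hs _ (Metric.self_subset_cthickening K hx₀K)
  refine ⟨x₀, hx₀K, h0, fun x hx => ?_⟩
  by_contra hxb
  have hxa : ε / 4 ≤ ‖x - a‖ := by simpa [dist_eq_norm] using hxb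
  have hpos : 0 < ‖x - a‖ := by linarith
  -- A cell leaving the ball would contain a point at distance exactly `ε / 4` from `a`. That point
  -- is still within `ε` of `K`, yet its distance to the codebook exceeds `σ`.
  have hy := segment_mem_cell has hx (t := ε / 4 / ‖x - a‖) (by positivity)
    ((div_le_one hpos).2 hxa)
  have hya : ‖a + (ε / 4 / ‖x - a‖) • (x - a) - a‖ = ε / 4 := by
    rw [add_sub_cancel_left, norm_smul, Real.norm_of_nonneg (by positivity)]
    field_simp
  have h1 := infDist_eq_norm_of_mem_cell hy
  have h2 := hs (a + (ε / 4 / ‖x - a‖) • (x - a))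
    (Metric.mem_cthickening_of_dist_le _ x₀ ε K hx₀K (by
      have := dist_triangle (a + (ε / 4 / ‖x - a‖) • (x - a)) a x₀
      rw [dist_eq_norm, dist_eq_norm, dist_eq_norm, hya] at this
      rw [dist_eq_norm]
      linarith))
  rw [h1, hya] at h2
  linarith

lemma exists_mem_ne_norm_sub_le [Nontrivial E] {s : Finset E} {U : Set E} {a : E} {ρ : ℝ}
    (hρ : 0 < ρ) (hs : s.Nonempty) (hU : ∀ x, ‖x - a‖ ≤ 2 * ρ → x ∈ U)
    (hd : ∀ x ∈ U, Metric.infDist x (s : Set E) ≤ ρ) :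
    ∃ b ∈ s, b ≠ a ∧ ‖a - b‖ ≤ 3 * ρ := by
  -- The codebook point nearest to `a + v` is within `ρ` of it, while `a` is at distance `2 * ρ`;
  -- hence that point is not `a`.
  obtain ⟨v, hv⟩ := exists_norm_eq E (show 0 ≤ 2 * ρ by positivity)
  obtain ⟨b, hb, hbd⟩ := exists_mem_norm_sub_eq_infDist hs (a + v)
  have h1 : ‖a + v - b‖ ≤ ρ := by
    rw [hbd]
    exact hd _ (hU _ (by simp [hv]))
  refine ⟨b, hb, ?_, ?_⟩
  · rintro rfl
    rw [add_sub_cancel_left, hv] at h1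
    linarith
  · have := norm_sub_le (a + v - b) v
    rw [show a + v - b - v = a - b by abel, hv] at this
    linarith

end Geometry

/-! ### Cost of deleting a point and gain from inserting one -/

section Distortion

variable {E : Type*} [NormedAddCommGroup E] [MeasurableSpace E] {P : Measure E} {r : ℝ}

/-- Deleting `a` changes the distance to the codebook only on the open cell: elsewhere, ties
included, another point does as well. -/
lemma distortion_erase_le [OpensMeasurableSpace E] [DecidableEq E] {s : Finset E} {a b : E}
    (hr : 0 < r) (ha : a ∈ s)
    (hb : b ∈ s) (hba : b ≠ a) {t : ℝ} (ht : ∀ x ∈ openCell a s, ‖x - b‖ ≤ t) :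
    distortion P r (s.erase a) ≤ distortion P r s + ENNReal.ofReal t ^ r * P (openCell a s) := by
  have hm := (isOpen_openCell a s).measurableSet
  rw [distortion, distortion, ← setLIntegral_const, ← lintegral_indicator hm,
    ← lintegral_add_right _ (measurable_const.indicator hm)]
  refine lintegral_mono fun x => ?_
  rw [Finset.coe_erase]
  by_cases hx : x ∈ openCell a s
  · rw [Set.indicator_of_mem hx]
    refine le_add_left (ENNReal.rpow_le_rpow ?_ hr.le)
    have hbs : b ∈ (s : Set E) \ {a} := ⟨by exact_mod_cast hb, hba⟩
    refine (Metric.infEDist_le_edist_of_mem hbs).trans ?_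
    rw [edist_dist, dist_eq_norm]
    exact ENNReal.ofReal_le_ofReal (ht x hx)
  · rw [Set.indicator_of_notMem hx, add_zero, infEDist_eq_min_sdiff ha, min_eq_right (not_lt.1 hx)]

/-- On the ball of radius `t / 4` around `x₀`, the distance falls from at least `3t / 4` to at most
`t / 4`. -/
lemma distortion_insert_add_le [OpensMeasurableSpace E] [DecidableEq E] {s : Finset E} {x₀ : E}
    {t : ℝ} (hr : 0 < r)
    (ht : 0 ≤ t) (hx₀ : ENNReal.ofReal t ≤ Metric.infEDist x₀ (s : Set E)) :
    distortion P r (insert x₀ s) +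
      ENNReal.ofReal (((3 / 4) ^ r - (1 / 4) ^ r) * t ^ r) * P (Metric.ball x₀ (t / 4)) ≤
      distortion P r s := by
  have hm : MeasurableSet (Metric.ball x₀ (t / 4)) := measurableSet_ball
  rw [distortion, distortion, ← setLIntegral_const, ← lintegral_indicator hm,
    ← lintegral_add_right _ (measurable_const.indicator hm)]
  refine lintegral_mono fun x => ?_
  have hins : Metric.infEDist x ((insert x₀ s : Finset E) : Set E) ≤ Metric.infEDist x (s : Set E) :=
    Metric.infEDist_anti (by simp)
  by_cases hx : x ∈ Metric.ball x₀ (t / 4)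
  · rw [Set.indicator_of_mem hx]
    have hx' : edist x x₀ ≤ ENNReal.ofReal (t / 4) := by
      rw [edist_dist]
      exact ENNReal.ofReal_le_ofReal (le_of_lt hx)
    have h1 : Metric.infEDist x ((insert x₀ s : Finset E) : Set E) ≤ ENNReal.ofReal (t / 4) :=
      (Metric.infEDist_le_edist_of_mem (by simp)).trans hx'
    have h2 : ENNReal.ofReal (3 / 4 * t) ≤ Metric.infEDist x (s : Set E) := by
      have h3 : ENNReal.ofReal (3 / 4 * t) + ENNReal.ofReal (t / 4) ≤
          Metric.infEDist x (s : Set E) + ENNReal.ofReal (t / 4) := by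
        rw [← ENNReal.ofReal_add (by positivity) (by positivity),
          show 3 / 4 * t + t / 4 = t by ring]
        calc _ ≤ _ := hx₀
          _ ≤ Metric.infEDist x (s : Set E) + edist x₀ x := Metric.infEDist_le_infEDist_add_edist
          _ ≤ _ := by rw [edist_comm]; gcongr
      exact (ENNReal.add_le_add_iff_right ENNReal.ofReal_ne_top).1 h3
    have hpow : (1 / 4 : ℝ) ^ r ≤ (3 / 4) ^ r :=
      Real.rpow_le_rpow (by norm_num) (by norm_num) hr.le
    calc _ ≤ ENNReal.ofReal (t / 4) ^ r +
          ENNReal.ofReal (((3 / 4) ^ r - (1 / 4) ^ r) * t ^ r) := by gcongr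
      _ = ENNReal.ofReal (3 / 4 * t) ^ r := by
          rw [ENNReal.ofReal_rpow_of_nonneg (by positivity) hr.le,
            ENNReal.ofReal_rpow_of_nonneg (by positivity) hr.le,
            ← ENNReal.ofReal_add (by positivity)
              (mul_nonneg (sub_nonneg.2 hpow) (by positivity)),
            show t / 4 = 1 / 4 * t by ring, Real.mul_rpow (by norm_num) ht,
            Real.mul_rpow (by norm_num) ht]
          ring_nf
      _ ≤ _ := by gcongr
  · rw [Set.indicator_of_notMem hx, add_zero]
    gcongr

lemma distortion_ne_top_of_moment [BorelSpace E] [IsProbabilityMeasure P] {δ : ℝ} (hr : 0 < r)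
    (hδ : 0 < δ) (hint : Integrable (fun x => ‖x‖ ^ (r + δ)) P) :
    distortion P r ({0} : Finset E) ≠ ∞ := by
  have h1 : Integrable (fun x : E => 1 + ‖x‖ ^ (r + δ)) P := (integrable_const 1).add hint
  refine ne_top_of_le_ne_top h1.lintegral_lt_top.ne ?_
  refine lintegral_mono fun x => ?_
  rw [Finset.coe_singleton, Metric.infEDist_singleton, edist_rpow_eq_ofReal x 0 hr, sub_zero]
  refine ENNReal.ofReal_le_ofReal ?_
  rcases le_total ‖x‖ 1 with h | h
  · have := Real.rpow_le_one (norm_nonneg x) h hr.le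
    have := Real.rpow_nonneg (norm_nonneg x) (r + δ)
    linarith
  · have := Real.rpow_le_rpow_of_exponent_le h (show r ≤ r + δ by linarith)
    linarith

lemma IsOptimal.distortion_ne_top [BorelSpace E] [IsProbabilityMeasure P] {δ : ℝ} (hr : 0 < r)
    (hδ : 0 < δ) (hint : Integrable (fun x => ‖x‖ ^ (r + δ)) P) {n : ℕ} (hn : 1 ≤ n) {s : Finset E}
    (hs : IsOptimal P r n s) : distortion P r s ≠ ∞ := by
  rw [hs.2]
  exact ne_top_of_le_ne_top (distortion_ne_top_of_moment hr hδ hint)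
    (iInf₂_le ({0} : Finset E) (by simpa using hn))

lemma nonempty_of_distortion_ne_top [IsProbabilityMeasure P] (hr : 0 < r) {s : Finset E}
    (hs : distortion P r s ≠ ∞) : s.Nonempty := by
  rw [Finset.nonempty_iff_ne_empty]
  rintro rfl
  simp [distortion, hr] at hs

variable [NormedSpace ℝ E] [FiniteDimensional ℝ E] [Nontrivial E] [BorelSpace E] {μ : Measure E}
  [μ.IsAddHaarMeasure] {d : ℕ} {h : E → ℝ}

/-- `n` balls of radius `n^{-1/d} / 2` do not cover the unit ball. -/
lemma exists_ball_infEDist_ge (hd : Module.finrank ℝ E = d) {n : ℕ} (hn : 1 ≤ n) {s : Finset E}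
    (hs : s.card ≤ n) : ∃ x ∈ Metric.ball (0 : E) 1,
      ENNReal.ofReal (1 / 2 * (n : ℝ) ^ (-(1 / (d : ℝ)))) ≤ Metric.infEDist x (s : Set E) := by
  have hd1 : 1 ≤ d := hd ▸ Module.finrank_pos
  let μ : Measure E := Measure.addHaar
  set t : ℝ := 1 / 2 * (n : ℝ) ^ (-(1 / (d : ℝ))) with ht
  have hn0 : (0 : ℝ) < n := by exact_mod_cast hn
  have ht0 : 0 < t := by positivity
  by_contra! hcon
  have hsub : Metric.ball (0 : E) 1 ⊆ ⋃ b ∈ s, Metric.ball b t := by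
    intro x hx
    obtain ⟨b, hb, hlt⟩ := Metric.infEDist_lt_iff.1 (hcon x hx)
    rw [edist_dist, ENNReal.ofReal_lt_ofReal_iff ht0] at hlt
    exact Set.mem_iUnion₂.2 ⟨b, by exact_mod_cast hb, hlt⟩
  have htd : t ^ d = (1 / 2) ^ d * (n : ℝ)⁻¹ := by
    rw [ht, mul_pow, ← Real.rpow_natCast (_ ^ _), ← Real.rpow_mul hn0.le,
      show -(1 / (d : ℝ)) * d = -1 by field_simp, Real.rpow_neg_one]
  have hV0 : μ (Metric.ball (0 : E) 1) ≠ 0 := (Metric.measure_ball_pos μ 0 one_pos).ne'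
  have hV : μ (Metric.ball (0 : E) 1) ≠ ∞ := measure_ball_lt_top.ne
  have h1 : μ (Metric.ball (0 : E) 1) ≤
      ENNReal.ofReal (n * t ^ d) * μ (Metric.ball (0 : E) 1) :=
    calc μ (Metric.ball (0 : E) 1) ≤ μ (⋃ b ∈ s, Metric.ball b t) := measure_mono hsub
      _ ≤ ∑ b ∈ s, μ (Metric.ball b t) := measure_biUnion_finset_le _ _
      _ = s.card * (ENNReal.ofReal (t ^ d) * μ (Metric.ball (0 : E) 1)) := by
          simp [μ.addHaar_ball _ ht0.le, hd]
      _ ≤ n * (ENNReal.ofReal (t ^ d) * μ (Metric.ball (0 : E) 1)) := by gcongr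
      _ = _ := by
          rw [ENNReal.ofReal_mul hn0.le, ENNReal.ofReal_natCast, mul_assoc]
  -- The factor `1 / 2` in the radius makes the total volume `(1 / 2) ^ d < 1` times that of the
  -- unit ball.
  have h2 : (n : ℝ) * t ^ d < 1 := by
    rw [htd, mul_comm ((1 / 2 : ℝ) ^ d), mul_inv_cancel_left₀ hn0.ne']
    exact pow_lt_one₀ (by norm_num) (by norm_num) (by omega)
  have h3 : ENNReal.ofReal (n * t ^ d) * μ (Metric.ball (0 : E) 1) <
      1 * μ (Metric.ball (0 : E) 1) :=
    ENNReal.mul_lt_mul_left hV0 hV (by rwa [ENNReal.ofReal_lt_one])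
  rw [one_mul] at h3
  exact absurd h1 (not_le.2 h3)

/-- Adding one point to a codebook with at most `n` points can reduce the distortion by a
quantity of order `n^{-(1+r/d)}`. -/
lemma exists_forall_distortion_insert_add_le [DecidableEq E] (hd : Module.finrank ℝ E = d)
    (hr : 0 < r)
    (hP : P = μ.withDensity (fun x => ENNReal.ofReal (h x)))
    (h_pos : ∀ ρ : ℝ, 0 < ρ → ∃ cρ : ℝ, 0 < cρ ∧ ∀ x ∈ Metric.closedBall (0 : E) ρ, cρ ≤ h x) :
    ∃ C : ℝ, 0 < C ∧ ∀ n : ℕ, 1 ≤ n → ∀ s : Finset E, s.card ≤ n → ∃ x₀ : E,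
      distortion P r (insert x₀ s) + ENNReal.ofReal (C * (n : ℝ) ^ (-(1 + r / d))) ≤
        distortion P r s := by
  have hd1 : 1 ≤ d := hd ▸ Module.finrank_pos
  -- Radius `2` suffices: the hole is centred in the unit ball and the ball used has radius `t / 4 ≤
  -- 1 / 8`. The constant thus does not depend on `K`.
  obtain ⟨κ, hκ, hκh⟩ := h_pos 2 two_pos
  have hV : 0 < μ.real (Metric.ball (0 : E) 1) :=
    ENNReal.toReal_pos (Metric.measure_ball_pos μ 0 one_pos).ne' measure_ball_lt_top.ne
  have hpow : (1 / 4 : ℝ) ^ r < (3 / 4) ^ r :=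
    Real.rpow_lt_rpow (by norm_num) (by norm_num) hr
  refine ⟨((3 / 4) ^ r - (1 / 4) ^ r) * (1 / 2) ^ r *
    (κ * μ.real (Metric.ball (0 : E) 1) * (1 / 8) ^ d),
    mul_pos (mul_pos (sub_pos.2 hpow) (by positivity)) (by positivity), fun n hn s hs => ?_⟩
  have hn0 : (0 : ℝ) < n := by exact_mod_cast hn
  have hn1 : (1 : ℝ) ≤ n := by exact_mod_cast hn
  obtain ⟨x₀, hx₀, hinf⟩ := exists_ball_infEDist_ge hd hn hs
  set t : ℝ := 1 / 2 * (n : ℝ) ^ (-(1 / (d : ℝ))) with ht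
  have ht0 : 0 < t := by positivity
  have ht1 : t ≤ 1 / 2 := by
    have : (n : ℝ) ^ (-(1 / (d : ℝ))) ≤ 1 :=
      Real.rpow_le_one_of_one_le_of_nonpos hn1 (by simp)
    linarith
  have hPB : ENNReal.ofReal (κ * μ.real (Metric.ball (0 : E) 1) * (t / 4) ^ d) ≤
      P (Metric.ball x₀ (t / 4)) := by
    rw [hP, withDensity_apply _ measurableSet_ball]
    calc _ = ENNReal.ofReal κ * μ (Metric.ball x₀ (t / 4)) := by
          rw [μ.addHaar_ball x₀ (by positivity), hd, mul_assoc, ENNReal.ofReal_mul hκ.le,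
            mul_comm (μ.real _), ENNReal.ofReal_mul (by positivity),
            ofReal_measureReal measure_ball_lt_top.ne]
      _ = ∫⁻ x in Metric.ball x₀ (t / 4), ENNReal.ofReal κ ∂μ := (setLIntegral_const _ _).symm
      _ ≤ _ := by
          refine setLIntegral_mono' measurableSet_ball fun x hx => ?_
          refine ENNReal.ofReal_le_ofReal (hκh x ?_)
          have := dist_triangle x x₀ 0
          rw [Metric.mem_ball] at hx hx₀
          rw [Metric.mem_closedBall]
          linarith
  refine ⟨x₀, le_trans ?_ (distortion_insert_add_le hr ht0.le hinf)⟩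
  gcongr
  refine le_trans (le_of_eq ?_) (mul_le_mul_right hPB _)
  rw [← ENNReal.ofReal_mul (mul_nonneg (sub_pos.2 hpow).le (by positivity))]
  congr 1
  have e1 : t ^ r = (1 / 2) ^ r * (n : ℝ) ^ (-(r / d)) := by
    rw [ht, Real.mul_rpow (by norm_num) (by positivity), ← Real.rpow_mul hn0.le]
    congr 2
    ring
  have e2 : (t / 4) ^ d = (1 / 8) ^ d * (n : ℝ) ^ (-1 : ℝ) := by
    rw [ht, show 1 / 2 * (n : ℝ) ^ (-(1 / (d : ℝ))) / 4 = 1 / 8 * (n : ℝ) ^ (-(1 / (d : ℝ))) by ring,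
      mul_pow, ← Real.rpow_natCast (_ ^ _), ← Real.rpow_mul hn0.le,
      show -(1 / (d : ℝ)) * d = -1 by field_simp]
  rw [e1, e2, show -(1 + r / d) = -(r / d) + -1 by ring, Real.rpow_add hn0]
  ring

end Distortion

/-! ### Real representatives of the essential bounds -/

section EssentialBounds

variable {E : Type*} [MeasurableSpace E] {μ : Measure E} {h : E → ℝ}

lemma exists_essInfOn_eq_ofReal {A : Set E} (hA : μ A ≠ 0) {κ : ℝ} (hκ : 0 < κ)
    (hAm : MeasurableSet A) (hκh : ∀ x ∈ A, κ ≤ h x) :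
    ∃ m : ℝ, κ ≤ m ∧ essInfOn μ h A = ENNReal.ofReal m ∧ ∀ᵐ x ∂μ.restrict A, m ≤ h x := by
  have hle : ∀ᵐ x ∂μ.restrict A, essInfOn μ h A ≤ ENNReal.ofReal (h x) := ae_essInf_le
  have hge : ENNReal.ofReal κ ≤ essInfOn μ h A := by
    refine le_essInf_of_ae_le _ ?_
    filter_upwards [ae_restrict_mem hAm] with x hx using ENNReal.ofReal_le_ofReal (hκh x hx)
  have : NeBot (ae (μ.restrict A)) := by
    rw [ae_neBot]
    rwa [Ne, Measure.restrict_eq_zero]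
  obtain ⟨x₁, hx₁⟩ := hle.exists
  have hne : essInfOn μ h A ≠ ∞ := ne_top_of_le_ne_top ENNReal.ofReal_ne_top hx₁
  refine ⟨(essInfOn μ h A).toReal, (ENNReal.ofReal_le_iff_le_toReal hne).1 hge,
    (ENNReal.ofReal_toReal hne).symm, ?_⟩
  filter_upwards [hle, ae_restrict_mem hAm] with x hx hxA
  exact ENNReal.toReal_le_of_le_ofReal (hκ.le.trans (hκh x hxA)) hx

lemma exists_essSupOn_eq_ofReal {A : Set E} (hA : μ A ≠ 0) {m : ℝ}
    (hm : ∀ᵐ x ∂μ.restrict A, m ≤ h x) (hne : essSupOn μ h A ≠ ∞) :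
    ∃ M : ℝ, m ≤ M ∧ essSupOn μ h A = ENNReal.ofReal M ∧ ∀ᵐ x ∂μ.restrict A, h x ≤ M := by
  have hle : ∀ᵐ x ∂μ.restrict A, ENNReal.ofReal (h x) ≤ essSupOn μ h A := ae_le_essSup
  have hle' : ∀ᵐ x ∂μ.restrict A, h x ≤ (essSupOn μ h A).toReal := by
    filter_upwards [hle] with x hx
    exact (ENNReal.ofReal_le_iff_le_toReal hne).1 hx
  have : NeBot (ae (μ.restrict A)) := by
    rw [ae_neBot]
    rwa [Ne, Measure.restrict_eq_zero]
  obtain ⟨x₁, hx₁, hx₁'⟩ := (hle'.and hm).exists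
  exact ⟨_, hx₁'.trans hx₁, (ENNReal.ofReal_toReal hne).symm, hle'⟩

end EssentialBounds

lemma exists_pos_le_on_cthickening {E : Type*} [NormedAddCommGroup E] {h : E → ℝ}
    (h_pos : ∀ ρ : ℝ, 0 < ρ → ∃ cρ : ℝ, 0 < cρ ∧ ∀ x ∈ Metric.closedBall (0 : E) ρ, cρ ≤ h x)
    {K : Set E} (hK : Bornology.IsBounded K) (ε : ℝ) :
    ∃ κ : ℝ, 0 < κ ∧ ∀ x ∈ Metric.cthickening ε K, κ ≤ h x := by
  obtain ⟨ρ, hρ, hsub⟩ := (hK.cthickening (δ := ε)).subset_closedBall_lt 0 (0 : E)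
  obtain ⟨κ, hκ, hκh⟩ := h_pos ρ hρ
  exact ⟨κ, hκ, fun x hx => hκh x (hsub hx)⟩

/-! ### Localization of cells near a compact set -/

section LocalBounds

variable {E : Type*} [NormedAddCommGroup E] [MeasurableSpace E] {μ : Measure E} {h : E → ℝ}

lemma measure_cthickening_ne_zero [OpensMeasurableSpace E] [μ.IsOpenPosMeasure] {K : Set E}
    (hK : K.Nonempty) {ε : ℝ} (hε : 0 < ε) : μ (Metric.cthickening ε K) ≠ 0 := by
  have h1 : (Metric.thickening ε K).Nonempty := hK.mono (Metric.self_subset_thickening hε K)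
  exact ne_of_gt <| (Metric.isOpen_thickening.measure_pos μ h1).trans_le
    (measure_mono (Metric.thickening_subset_cthickening ε K))

variable [NormedSpace ℝ E] [FiniteDimensional ℝ E] [Nontrivial E] [BorelSpace E] {d : ℕ}
  {r c : ℝ}

/-- Uniform control, for large `n`, of the cells meeting a compact set. -/
lemma exists_forall_meeting_bounds [μ.IsOpenPosMeasure] (hd : Module.finrank ℝ E = d) (hr : 0 < r)
    (hc : 0 < c) {α : ℕ → Finset E} (hne : ∀ n, 1 ≤ n → (α n).Nonempty)
    (hα : SharpMicroMacro d r c h α) {K : Set E} (hK : IsCompact K)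
    {ε : ℝ} (hε : 0 < ε) {κ m : ℝ} (hκ : 0 < κ) (hκh : ∀ x ∈ Metric.cthickening ε K, κ ≤ h x)
    (hκm : κ ≤ m) (hm : ∀ᵐ x ∂μ.restrict (Metric.cthickening ε K), m ≤ h x) :
    ∃ N : ℕ, 1 ≤ N ∧ ∀ n ≥ N, ∀ a ∈ meeting (α n) K,
      cell a (α n) ⊆ Metric.cthickening ε K ∧
      (∀ x ∈ cell a (α n), 0 < h x ∧
        ‖x - a‖ ≤ c * (n : ℝ) ^ (-(1 / (d : ℝ))) * h x ^ (-(1 / (r + d)))) ∧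
      (∀ x ∈ cell a (α n), ‖x - a‖ ≤ c * (n : ℝ) ^ (-(1 / (d : ℝ))) * m ^ (-(1 / (r + d)))) ∧
      ∃ b ∈ α n, b ≠ a ∧ ‖a - b‖ ≤ 3 * (c * (n : ℝ) ^ (-(1 / (d : ℝ))) * m ^ (-(1 / (r + d)))) := by
  have hd1 : 1 ≤ d := hd ▸ Module.finrank_pos
  obtain ⟨N, hN⟩ := hα _ (hK.cthickening (r := ε))
  have htend : Tendsto (fun n : ℕ => c * (n : ℝ) ^ (-(1 / (d : ℝ))) * κ ^ (-(1 / (r + d)))) atTop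
      (nhds 0) := by
    have := ((tendsto_rpow_neg_atTop (show 0 < 1 / (d : ℝ) by positivity)).comp
      tendsto_natCast_atTop_atTop).const_mul c |>.mul_const (κ ^ (-(1 / (r + d))))
    simpa using this
  obtain ⟨N', hN'⟩ := eventually_atTop.1
    -- `ε / 16` leaves room for both uses: `σ < ε / 4` to confine the cells, and `2 * ρ < ε / 2` to
    -- find a neighbour of `a` inside the thickening.
    (htend.eventually (gt_mem_nhds (show 0 < ε / 16 by positivity)))
  refine ⟨max 1 (max N N'), le_max_left _ _, fun n hn a ha => ?_⟩
  have hn1 : 1 ≤ n := (le_max_left _ _).trans hn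
  have hnN : N ≤ n := ((le_max_left _ _).trans (le_max_right _ _)).trans hn
  have hn0 : (0 : ℝ) < n := by exact_mod_cast hn1
  have hσ := hN' n (((le_max_right _ _).trans (le_max_right _ _)).trans hn)
  have hsharp := hN n hnN
  set τ : ℝ := c * (n : ℝ) ^ (-(1 / (d : ℝ))) with hτ
  have hτ0 : 0 < τ := by positivity
  -- Two scales: `σ`, from the pointwise bound `κ`, serves only to localize; `ρ`, from the essential
  -- infimum `m`, enters the final estimates.
  set σ : ℝ := τ * κ ^ (-(1 / (r + d)))
  set ρ : ℝ := τ * m ^ (-(1 / (r + d))) with hρ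
  have hm0 : 0 < m := hκ.trans_le hκm
  have hρ0 : 0 < ρ := by positivity
  have hexp : -(1 / (r + d)) ≤ 0 := by
    have : 0 < 1 / (r + d) := by positivity
    linarith
  have hρσ : ρ ≤ σ := by
    have := Real.rpow_le_rpow_of_nonpos hκ hκm hexp
    exact mul_le_mul_of_nonneg_left this hτ0.le
  have hfine : ∀ x ∈ Metric.cthickening ε K, Metric.infDist x (α n : Set E) ≤ σ := by
    intro x hx
    refine (hsharp x hx).trans ?_
    have := Real.rpow_le_rpow_of_nonpos hκ (hκh x hx) hexp
    exact mul_le_mul_of_nonneg_left this hτ0.le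
  -- The open thickening is needed here, so that the almost everywhere bound extends to every point.
  have hfine' : ∀ x ∈ Metric.thickening ε K, Metric.infDist x (α n : Set E) ≤ ρ := by
    refine infDist_le_of_ae_le (μ := μ) Metric.isOpen_thickening ?_
    rw [ae_restrict_iff' Metric.isClosed_cthickening.measurableSet] at hm
    filter_upwards [hm] with x hx hxK
    have hxK' := Metric.thickening_subset_cthickening ε K hxK
    refine (hsharp x hxK').trans ?_
    have := Real.rpow_le_rpow_of_nonpos hm0 (hx hxK') hexp
    exact mul_le_mul_of_nonneg_left this hτ0.le
  obtain ⟨x₀, hx₀, hax₀, hball⟩ := cell_subset_ball (by linarith) hfine ha hε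
  have hnear : ∀ x, ‖x - a‖ < ε / 2 → x ∈ Metric.thickening ε K := by
    intro x hx
    refine Metric.mem_thickening_iff.2 ⟨x₀, hx₀, ?_⟩
    have := norm_add_le (x - a) (a - x₀)
    rw [sub_add_sub_cancel] at this
    rw [dist_eq_norm]
    linarith
  have hcell : cell a (α n) ⊆ Metric.thickening ε K := fun x hx => hnear x (by
    have := hball hx
    rw [Metric.mem_ball, dist_eq_norm] at this
    linarith)
  have hcell' := hcell.trans (Metric.thickening_subset_cthickening ε K)
  refine ⟨hcell', fun x hx => ⟨hκ.trans_le (hκh x (hcell' hx)), ?_⟩, fun x hx => ?_, ?_⟩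
  · rw [← infDist_eq_norm_of_mem_cell hx]
    exact hsharp x (hcell' hx)
  · rw [← infDist_eq_norm_of_mem_cell hx]
    exact hfine' x (hcell hx)
  · exact exists_mem_ne_norm_sub_le hρ0 (hne n hn1) (fun x hx => hnear x (by linarith)) hfine'

end LocalBounds

/-! ### Normalized bounds for a single cell -/

lemma measure_cell_eq {E : Type*} [NormedAddCommGroup E] [MeasurableSpace E] [BorelSpace E]
    {μ P : Measure E} {h : E → ℝ} (hP : P = μ.withDensity (fun x => ENNReal.ofReal (h x)))
    (a : E) (s : Finset E) : P (cell a s) = ∫⁻ x in cell a s, ENNReal.ofReal (h x) ∂μ := by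
  rw [hP, withDensity_apply _ (isClosed_cell a s).measurableSet]

lemma localInertia_eq {E : Type*} [NormedAddCommGroup E] [MeasurableSpace E] [BorelSpace E]
    {μ P : Measure E} {h : E → ℝ} (h_meas : Measurable h)
    (hP : P = μ.withDensity (fun x => ENNReal.ofReal (h x))) (r : ℝ) (a : E) (s : Finset E) :
    localInertia P r a s = ∫⁻ x in cell a s, ENNReal.ofReal (h x) * edist x a ^ r ∂μ := by
  rw [localInertia, hP, setLIntegral_withDensity_eq_setLIntegral_mul _ h_meas.ennreal_ofReal
    (show Measurable fun x => edist x a ^ r by fun_prop) (isClosed_cell a s).measurableSet]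
  rfl

section CellBounds

variable {E : Type*} [NormedAddCommGroup E] [NormedSpace ℝ E] [FiniteDimensional ℝ E]
  [Nontrivial E] [MeasurableSpace E] [BorelSpace E] {μ : Measure E} [μ.IsAddHaarMeasure]
  {d : ℕ} {r c : ℝ} {P : Measure E} {h : E → ℝ} {s : Finset E} {a : E} {n : ℕ} {m M : ℝ}

lemma natCast_rpow_eq_ofReal (hn : 1 ≤ n) (q : ℝ) :
    (n : ℝ≥0∞) ^ q = ENNReal.ofReal ((n : ℝ) ^ q) := by
  rw [← ENNReal.ofReal_rpow_of_pos (by exact_mod_cast hn), ENNReal.ofReal_natCast]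

lemma natCast_mul_measure_cell_le (hd : Module.finrank ℝ E = d) (hr : 0 < r) (hc : 0 < c)
    (hP : P = μ.withDensity (fun x => ENNReal.ofReal (h x))) (hn : 1 ≤ n) (hM : 0 < M)
    (hhM : ∀ᵐ x ∂μ.restrict (cell a s), h x ≤ M)
    (hh : ∀ x ∈ cell a s, 0 < h x ∧
        ‖x - a‖ ≤ c * (n : ℝ) ^ (-(1 / (d : ℝ))) * h x ^ (-(1 / (r + d)))) :
    (n : ℝ≥0∞) * P (cell a s) ≤
      ENNReal.ofReal (μ.real (Metric.ball 0 1) * (1 + d / r) * c ^ d * M ^ (r / (r + d))) := by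
  have hd1 : 1 ≤ d := hd ▸ Module.finrank_pos
  have hn0 : (0 : ℝ) < n := by exact_mod_cast hn
  have h1 := setLIntegral_density_le hd hr (show 0 < c * (n : ℝ) ^ (-(1 / (d : ℝ))) by positivity) hM
    (isClosed_cell a s).measurableSet hhM hh
  rw [← measure_cell_eq hP] at h1
  refine (mul_le_mul_right h1 _).trans (le_of_eq ?_)
  rw [← ENNReal.ofReal_natCast, ← ENNReal.ofReal_mul hn0.le, mul_pow,
    ← Real.rpow_natCast (_ ^ _), ← Real.rpow_mul hn0.le,
      show -(1 / (d : ℝ)) * d = -1 by field_simp, Real.rpow_neg_one]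
  congr 1
  field_simp

lemma natCast_rpow_mul_localInertia_le (hd : Module.finrank ℝ E = d) (hr : 0 < r) (hc : 0 < c)
    (h_meas : Measurable h)
    (hP : P = μ.withDensity (fun x => ENNReal.ofReal (h x))) (hn : 1 ≤ n) (hm : 0 < m)
    (hmM : m ≤ M) (hhM : ∀ᵐ x ∂μ.restrict (cell a s), h x ≤ M)
    (hh : ∀ x ∈ cell a s, 0 < h x ∧
        ‖x - a‖ ≤ c * (n : ℝ) ^ (-(1 / (d : ℝ))) * h x ^ (-(1 / (r + d))))
    (hhm : ∀ x ∈ cell a s, ‖x - a‖ ≤ c * (n : ℝ) ^ (-(1 / (d : ℝ))) * m ^ (-(1 / (r + d)))) :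
    (n : ℝ≥0∞) ^ (1 + r / d) * localInertia P r a s ≤
      ENNReal.ofReal (μ.real (Metric.ball 0 1) * c ^ (r + d) * (1 + Real.log (M / m))) := by
  have hd1 : 1 ≤ d := hd ▸ Module.finrank_pos
  have hn0 : (0 : ℝ) < n := by exact_mod_cast hn
  have h1 := setLIntegral_density_mul_edist_rpow_le hd hr
    (show 0 < c * (n : ℝ) ^ (-(1 / (d : ℝ))) by positivity) hm hmM
    (isClosed_cell a s).measurableSet hhM hh hhm
  rw [← localInertia_eq h_meas hP] at h1
  refine (mul_le_mul_right h1 _).trans (le_of_eq ?_)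
  rw [natCast_rpow_eq_ofReal hn, ← ENNReal.ofReal_mul (by positivity),
    Real.mul_rpow hc.le (by positivity), ← Real.rpow_mul hn0.le,
    show -(1 / (d : ℝ)) * (r + d) = -(1 + r / d) by field_simp; ring, Real.rpow_neg hn0.le]
  congr 1
  field_simp

lemma le_natCast_mul_measure_openCell [DecidableEq E] (hd : Module.finrank ℝ E = d) (hr : 0 < r)
    (hc : 0 < c)
    {C : ℝ} (hn : 1 ≤ n) (hm : 0 < m) (hs : IsOptimal P r n s) (hfin : distortion P r s ≠ ∞)
    (hC : ∀ t : Finset E, t.card ≤ n → ∃ x₀ : E,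
      distortion P r (insert x₀ t) + ENNReal.ofReal (C * (n : ℝ) ^ (-(1 + r / d))) ≤
        distortion P r t)
    (ha : a ∈ s) {b : E} (hb : b ∈ s) (hba : b ≠ a)
    (hhm : ∀ x ∈ cell a s, ‖x - a‖ ≤ c * (n : ℝ) ^ (-(1 / (d : ℝ))) * m ^ (-(1 / (r + d))))
    (hab : ‖a - b‖ ≤ 3 * (c * (n : ℝ) ^ (-(1 / (d : ℝ))) * m ^ (-(1 / (r + d))))) :
    ENNReal.ofReal (C / (4 * c) ^ r * m ^ (r / (r + d))) ≤ n * P (openCell a s) := by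
  have hd1 : 1 ≤ d := hd ▸ Module.finrank_pos
  have hn0 : (0 : ℝ) < n := by exact_mod_cast hn
  set ρ : ℝ := c * (n : ℝ) ^ (-(1 / (d : ℝ))) * m ^ (-(1 / (r + d))) with hρ
  have hρ0 : 0 < ρ := by positivity
  have hcard := Finset.card_erase_add_one ha
  have hsn := hs.1
  -- Exchanging `a` for `x₀` keeps at most `n` points, so optimality of `s` applies.
  obtain ⟨x₀, hx₀⟩ := hC (s.erase a) (by omega)
  have h1 : distortion P r s ≤ distortion P r (insert x₀ (s.erase a)) := by
    rw [hs.2]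
    have hins := Finset.card_insert_le x₀ (s.erase a)
    exact iInf₂_le (insert x₀ (s.erase a)) (by omega)
  -- `4 * ρ` is the cell radius `ρ` plus the distance `3 * ρ` from `a` to `b`.
  have h2 := distortion_erase_le (P := P) hr ha hb hba (t := 4 * ρ) (fun x hx => by
    have h3 := hhm x (openCell_subset_cell ha hx)
    have h4 := norm_add_le (x - a) (a - b)
    rw [sub_add_sub_cancel] at h4
    linarith)
  have h3 : ENNReal.ofReal (C * (n : ℝ) ^ (-(1 + r / d))) ≤
      ENNReal.ofReal (4 * ρ) ^ r * P (openCell a s) :=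
    (ENNReal.add_le_add_iff_left hfin).1 ((add_le_add_left h1 _).trans (hx₀.trans h2))
  rw [ENNReal.ofReal_rpow_of_pos (by positivity)] at h3
  have e1 : (4 * ρ) ^ r = (4 * c) ^ r * ((n : ℝ) ^ (-(r / d)) * m ^ (-(r / (r + d)))) := by
    rw [hρ, show 4 * (c * (n : ℝ) ^ (-(1 / (d : ℝ))) * m ^ (-(1 / (r + d)))) =
      4 * c * ((n : ℝ) ^ (-(1 / (d : ℝ))) * m ^ (-(1 / (r + d)))) by ring,
      Real.mul_rpow (show 0 ≤ 4 * c by positivity) (by positivity),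
      Real.mul_rpow (x := (n : ℝ) ^ _) (by positivity) (by positivity), ← Real.rpow_mul hn0.le,
      ← Real.rpow_mul hm.le]
    congr 3 <;> ring
  have e2 : C / (4 * c) ^ r * m ^ (r / (r + d)) =
      n * ((4 * ρ) ^ r)⁻¹ * (C * (n : ℝ) ^ (-(1 + r / d))) := by
    rw [e1, Real.rpow_neg hn0.le, Real.rpow_neg hn0.le, Real.rpow_neg hm.le, Real.rpow_add hn0,
      Real.rpow_one]
    field_simp
  rw [e2, ENNReal.ofReal_mul (by positivity)]
  calc _ ≤ ENNReal.ofReal (n * ((4 * ρ) ^ r)⁻¹) *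
        (ENNReal.ofReal ((4 * ρ) ^ r) * P (openCell a s)) := by gcongr
    _ = _ := by
        rw [← mul_assoc, ← ENNReal.ofReal_mul (by positivity), mul_assoc,
          inv_mul_cancel₀ (by positivity), mul_one, ENNReal.ofReal_natCast]

lemma le_natCast_rpow_mul_localInertia (hd : Module.finrank ℝ E = d) (hr : 0 < r)
    (h_meas : Measurable h)
    (hP : P = μ.withDensity (fun x => ENNReal.ofReal (h x))) (hn : 1 ≤ n) (hm : 0 < m)
    (hmM : m ≤ M) (hhM : ∀ᵐ x ∂μ.restrict (cell a s), h x ≤ M) {D : ℝ} (hD : 0 < D)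
    (hDP : ENNReal.ofReal (D * m ^ (r / (r + d))) ≤ n * P (cell a s)) :
    ENNReal.ofReal (D ^ (1 + r / d) / (2 * (2 * μ.real (Metric.ball 0 1)) ^ (r / d)) *
      (m / M) ^ max 1 r) ≤ (n : ℝ≥0∞) ^ (1 + r / d) * localInertia P r a s := by
  have hd1 : 1 ≤ d := hd ▸ Module.finrank_pos
  have hn0 : (0 : ℝ) < n := by exact_mod_cast hn
  have hM : 0 < M := hm.trans_le hmM
  have hV : 0 < μ.real (Metric.ball (0 : E) 1) :=
    ENNReal.toReal_pos (Metric.measure_ball_pos μ 0 one_pos).ne' measure_ball_lt_top.ne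
  set V : ℝ := μ.real (Metric.ball (0 : E) 1)
  set p : ℝ := D * m ^ (r / (r + d)) / n with hp
  have hp0 : 0 < p := by positivity
  have hpP : ENNReal.ofReal p ≤ ∫⁻ x in cell a s, ENNReal.ofReal (h x) ∂μ := by
    rw [← measure_cell_eq hP, hp, ENNReal.ofReal_div_of_pos hn0, ENNReal.ofReal_natCast]
    exact ENNReal.div_le_of_le_mul' hDP
  -- Chosen so that `M * V * R ^ d = p / 2`.
  set R : ℝ := (p / (2 * V * M)) ^ (1 / (d : ℝ)) with hR
  have hR0 : 0 < R := by positivity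
  have hRd : R ^ d = p / (2 * V * M) := by
    rw [hR, ← Real.rpow_natCast, ← Real.rpow_mul (by positivity),
      show 1 / (d : ℝ) * d = 1 by field_simp, Real.rpow_one]
  have h1 := le_setLIntegral_density_mul_edist_rpow (a := a) hd hr (isClosed_cell a s).measurableSet
    hhM hM hR0 hp0.le (by rw [hRd]; refine le_of_eq ?_; change M * (V * _) = _; field_simp) hpP
  rw [← localInertia_eq h_meas hP] at h1
  refine le_trans ?_ (mul_le_mul_right h1 _)
  rw [natCast_rpow_eq_ofReal hn, ← ENNReal.ofReal_mul (by positivity)]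
  refine ENNReal.ofReal_le_ofReal ?_
  have hRr : R ^ r * p = p ^ (1 + r / d) / ((2 * V) ^ (r / d) * M ^ (r / d)) := by
    rw [hR, ← Real.rpow_mul (by positivity), show 1 / (d : ℝ) * r = r / d by ring,
      Real.div_rpow hp0.le (by positivity), Real.mul_rpow (by positivity) hM.le,
      Real.rpow_add hp0, Real.rpow_one]
    ring
  have hpp : p ^ (1 + r / d) = D ^ (1 + r / d) * m ^ (r / d) / (n : ℝ) ^ (1 + r / d) := by
    rw [hp, Real.div_rpow (by positivity) hn0.le, Real.mul_rpow hD.le (by positivity),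
      ← Real.rpow_mul hm.le]
    congr 3
    field_simp
    ring
  have e1 : (n : ℝ) ^ (1 + r / d) * (R ^ r * (p / 2)) =
      D ^ (1 + r / d) / (2 * (2 * V) ^ (r / d)) * (m / M) ^ (r / d) := by
    rw [← mul_div_assoc (R ^ r), hRr, hpp, Real.div_rpow hm.le hM.le]
    field_simp
  rw [e1]
  refine mul_le_mul_of_nonneg_left ?_ (by positivity)
  -- The argument yields the exponent `r / d`; since `m / M ≤ 1` and `r / d ≤ r`, the exponent `max
  -- 1 r` is weaker.
  refine Real.rpow_le_rpow_of_exponent_ge (by positivity) ((div_le_one hM).2 hmM) ?_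
  exact (div_le_self hr.le (by exact_mod_cast hd1)).trans (le_max_right _ _)

end CellBounds

/-! ### Passage to the limits in `n` and `ε` -/

section Limits

variable {ι : Type*}

lemma limsup_mul_biSup_le {u : ℕ → ℝ≥0∞} {S : ℕ → Set ι} {F : ℕ → ι → ℝ≥0∞} {B : ℝ≥0∞} {N : ℕ}
    (hB : ∀ n ≥ N, ∀ a ∈ S n, u n * F n a ≤ B) :
    limsup (fun n => u n * ⨆ a ∈ S n, F n a) atTop ≤ B := by
  refine limsup_le_of_le (h := eventually_atTop.2 ⟨N, fun n hn => ?_⟩)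
  simp_rw [ENNReal.mul_iSup]
  exact iSup₂_le fun a ha => hB n hn a ha

lemma le_liminf_mul_biInf {u : ℕ → ℝ≥0∞} {S : ℕ → Set ι} {F : ℕ → ι → ℝ≥0∞} {B : ℝ≥0∞} {N : ℕ}
    (hu : ∀ n ≥ N, u n ≠ 0 ∧ u n ≠ ∞) (hB : ∀ n ≥ N, ∀ a ∈ S n, B ≤ u n * F n a) :
    B ≤ liminf (fun n => u n * ⨅ a ∈ S n, F n a) atTop := by
  refine le_liminf_of_le (h := eventually_atTop.2 ⟨N, fun n hn => ?_⟩)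
  simp_rw [ENNReal.mul_iInf_of_ne (hu n hn).1 (hu n hn).2]
  exact le_iInf₂ fun a ha => hB n hn a ha

lemma le_ofReal_mul_iInf_rpow {L : ℝ≥0∞} {k q : ℝ} (hk : 0 < k) (hq : 0 < q)
    {f : ℝ → ℝ≥0∞} (hf : ∀ ε, 0 < ε → L ≤ ENNReal.ofReal k * f ε ^ q) :
    L ≤ ENNReal.ofReal k * (⨅ (ε : ℝ) (_ : 0 < ε), f ε) ^ q := by
  have hk0 : ENNReal.ofReal k ≠ 0 := by simpa using hk
  rw [mul_comm, ← ENNReal.div_le_iff_le_mul (Or.inl hk0) (Or.inl ENNReal.ofReal_ne_top),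
    ← ENNReal.rpow_inv_le_iff hq]
  refine le_iInf₂ fun ε hε => ?_
  rw [ENNReal.rpow_inv_le_iff hq, ENNReal.div_le_iff_le_mul (Or.inl hk0)
    (Or.inl ENNReal.ofReal_ne_top), mul_comm]
  exact hf ε hε

/-- Solving for `y` turns each hypothesis into `exp (L / k - 1) ≤ y`, a lower bound independent of
`ε` that passes to the infimum before logarithms are taken again. -/
lemma le_mul_one_add_log_iInf {L : ℝ≥0∞} {k : ℝ} (hk : 0 < k) {f : ℝ → ℝ≥0∞}
    (hf : ∀ ε, 0 < ε → f ε ≠ ∞ →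
      ∃ y : ℝ, 1 ≤ y ∧ f ε = ENNReal.ofReal y ∧ L ≤ ENNReal.ofReal (k * (1 + Real.log y))) :
    (L : EReal) ≤ (k : EReal) * (1 + ENNReal.log (⨅ (ε : ℝ) (_ : 0 < ε), f ε)) := by
  by_cases hinf : (⨅ (ε : ℝ) (_ : 0 < ε), f ε) = ∞
  · rw [hinf, ENNReal.log_top, EReal.add_top_of_ne_bot (by exact_mod_cast EReal.coe_ne_bot 1),
      EReal.coe_mul_top_of_pos hk]
    exact le_top
  have hL : L ≠ ∞ := by
    by_contra hL
    refine hinf (iInf₂_eq_top.2 fun ε hε => ?_)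
    by_contra hne
    obtain ⟨y, -, -, h⟩ := hf ε hε hne
    rw [hL] at h
    exact ENNReal.ofReal_ne_top (top_le_iff.1 h)
  set l : ℝ := L.toReal with hl
  have hle : ENNReal.ofReal (Real.exp (l / k - 1)) ≤ ⨅ (ε : ℝ) (_ : 0 < ε), f ε := by
    refine le_iInf₂ fun ε hε => ?_
    by_cases hne : f ε = ∞
    · rw [hne]; exact le_top
    obtain ⟨y, hy, hfy, h⟩ := hf ε hε hne
    rw [hfy]
    refine ENNReal.ofReal_le_ofReal ?_
    have hlog := Real.log_nonneg hy
    have h1 : l ≤ k * (1 + Real.log y) := ENNReal.toReal_le_of_le_ofReal (by positivity) h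
    rw [← Real.le_log_iff_exp_le (by linarith), sub_le_iff_le_add, div_le_iff₀ hk]
    linarith
  have hlog := ENNReal.log_le_log hle
  rw [ENNReal.log_ofReal_of_pos (Real.exp_pos _), Real.log_exp] at hlog
  have hkl : k * (1 + (l / k - 1)) = l := by field_simp; ring
  calc (L : EReal) = ((k * (1 + (l / k - 1)) : ℝ) : EReal) := by
        rw [hkl, hl, EReal.coe_ennreal_toReal hL]
    _ = (k : EReal) * (1 + ((l / k - 1 : ℝ) : EReal)) := by push_cast; rfl
    _ ≤ _ := by
        refine mul_le_mul_of_nonneg_left (add_le_add_right hlog _) ?_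
        exact_mod_cast hk.le

end Limits

end Quantization

/-! ### Assembly of the four estimates -/

theorem theorem4p9
    -- `ℝ^d` (`d ≥ 1`) with an arbitrary norm, and a Lebesgue measure `μ` on it
    {E : Type*} [NormedAddCommGroup E] [NormedSpace ℝ E] [FiniteDimensional ℝ E] [Nontrivial E]
    [MeasurableSpace E] [BorelSpace E] (μ : Measure E) [μ.IsAddHaarMeasure]
    (d : ℕ) (hd : Module.finrank ℝ E = d)
    (r : ℝ) (hr : 0 < r)
    -- the probability `P` with density `h`, and its moment condition
    (P : Measure E) [IsProbabilityMeasure P] (h : E → ℝ) (h_meas : Measurable h)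
    (hP : P = μ.withDensity (fun x => ENNReal.ofReal (h x)))
    (h_moment : ∃ δ : ℝ, 0 < δ ∧ Integrable (fun x => ‖x‖ ^ (r + δ)) P)
    -- `h` is bounded away from zero on compact sets
    (h_pos : ∀ ρ : ℝ, 0 < ρ → ∃ cρ : ℝ, 0 < cρ ∧ ∀ x ∈ Metric.closedBall (0 : E) ρ, cρ ≤ h x)
    (c : ℝ) (hc : 0 < c) :
    ∃ c₂₂ c₂₃ c₂₄ c₂₅ : ℝ, 0 < c₂₂ ∧ 0 < c₂₃ ∧ 0 < c₂₄ ∧ 0 < c₂₅ ∧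
      ∀ α : ℕ → Finset E,
        (∀ n : ℕ, 1 ≤ n → Quantization.IsOptimal P r n (α n)) →
        Quantization.SharpMicroMacro d r c h α →
        ∀ K : Set E, IsCompact K → K.Nonempty →
          (limsup (fun n : ℕ => (n : ℝ≥0∞) *
              ⨆ a ∈ Quantization.meeting (α n) K, P (Quantization.cell a (α n))) atTop
            ≤ ENNReal.ofReal c₂₂ *
              (⨅ (ε : ℝ) (_ : 0 < ε),
                Quantization.essSupOn μ h (Metric.cthickening ε K)) ^ (r / (r + d))) ∧
          (((limsup (fun n : ℕ => (n : ℝ≥0∞) ^ (1 + r / d) *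
              ⨆ a ∈ Quantization.meeting (α n) K,
                Quantization.localInertia P r a (α n)) atTop : ℝ≥0∞) : EReal)
            ≤ (c₂₃ : EReal) *
              (1 + ENNReal.log (⨅ (ε : ℝ) (_ : 0 < ε),
                Quantization.essSupOn μ h (Metric.cthickening ε K) /
                  Quantization.essInfOn μ h (Metric.cthickening ε K)))) ∧
          (ENNReal.ofReal c₂₄ *
              (⨆ (ε : ℝ) (_ : 0 < ε),
                Quantization.essInfOn μ h (Metric.cthickening ε K) ^ (r / (r + d)))
            ≤ liminf (fun n : ℕ => (n : ℝ≥0∞) *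
              ⨅ a ∈ Quantization.meeting (α n) K,
                P (Quantization.openCell a (α n))) atTop) ∧
          (ENNReal.ofReal c₂₅ *
              (⨆ (ε : ℝ) (_ : 0 < ε),
                (Quantization.essInfOn μ h (Metric.cthickening ε K) /
                  Quantization.essSupOn μ h (Metric.cthickening ε K)) ^ max 1 r)
            ≤ liminf (fun n : ℕ => (n : ℝ≥0∞) ^ (1 + r / d) *
              ⨅ a ∈ Quantization.meeting (α n) K,
                Quantization.localInertia P r a (α n)) atTop) := by
  classical
  have hd1 : 1 ≤ d := hd ▸ Module.finrank_pos
  have hV : 0 < μ.real (Metric.ball (0 : E) 1) :=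
    ENNReal.toReal_pos (Metric.measure_ball_pos μ 0 one_pos).ne' measure_ball_lt_top.ne
  obtain ⟨C, hC, hgain⟩ := Quantization.exists_forall_distortion_insert_add_le hd hr hP h_pos
  set D : ℝ := C / (4 * c) ^ r with hD
  have hD0 : 0 < D := by positivity
  refine ⟨μ.real (Metric.ball 0 1) * (1 + d / r) * c ^ d,
    μ.real (Metric.ball 0 1) * c ^ (r + d), D,
    D ^ (1 + r / d) / (2 * (2 * μ.real (Metric.ball 0 1)) ^ (r / d)),
    by positivity, by positivity, hD0, by positivity, fun α hopt hα K hK hKne => ?_⟩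
  obtain ⟨δ, hδ, hmom⟩ := h_moment
  have hfin : ∀ n, 1 ≤ n → Quantization.distortion P r (α n) ≠ ∞ := fun n hn =>
    (hopt n hn).distortion_ne_top hr hδ hmom hn
  have hne : ∀ n, 1 ≤ n → (α n).Nonempty := fun n hn =>
    Quantization.nonempty_of_distortion_ne_top hr (hfin n hn)
  -- Everything needed at a fixed `ε`; only the threshold `N` depends on `α`, while `D` was fixed
  -- before `α` and `K`.
  have key : ∀ ε : ℝ, 0 < ε → ∃ m : ℝ, 0 < m ∧
      Quantization.essInfOn μ h (Metric.cthickening ε K) = ENNReal.ofReal m ∧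
      (∀ᵐ x ∂μ.restrict (Metric.cthickening ε K), m ≤ h x) ∧
      ∃ N : ℕ, 1 ≤ N ∧ ∀ n ≥ N, ∀ a ∈ Quantization.meeting (α n) K,
      Quantization.cell a (α n) ⊆ Metric.cthickening ε K ∧
      (∀ x ∈ Quantization.cell a (α n), 0 < h x ∧
        ‖x - a‖ ≤ c * (n : ℝ) ^ (-(1 / (d : ℝ))) * h x ^ (-(1 / (r + d)))) ∧
      (∀ x ∈ Quantization.cell a (α n),
        ‖x - a‖ ≤ c * (n : ℝ) ^ (-(1 / (d : ℝ))) * m ^ (-(1 / (r + d)))) ∧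
      ENNReal.ofReal (D * m ^ (r / (r + d))) ≤ n * P (Quantization.openCell a (α n)) := by
    intro ε hε
    obtain ⟨κ, hκ, hκh⟩ := Quantization.exists_pos_le_on_cthickening h_pos hK.isBounded ε
    obtain ⟨m, hκm, hm, hmh⟩ := Quantization.exists_essInfOn_eq_ofReal
      (Quantization.measure_cthickening_ne_zero (μ := μ) hKne hε) hκ
      Metric.isClosed_cthickening.measurableSet hκh
    obtain ⟨N, hN1, hN⟩ := Quantization.exists_forall_meeting_bounds hd hr hc hne hα hK hε hκ hκh
      hκm hmh
    refine ⟨m, hκ.trans_le hκm, hm, hmh, N, hN1, fun n hn a ha => ?_⟩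
    obtain ⟨h1, h2, h3, b, hb, hba, hab⟩ := hN n hn a ha
    have hn1 := hN1.trans hn
    exact ⟨h1, h2, h3, Quantization.le_natCast_mul_measure_openCell hd hr hc hn1
      (hκ.trans_le hκm) (hopt n hn1) (hfin n hn1) (hgain n hn1) ha.1 hb hba h3 hab⟩
  have hsup : ∀ ε : ℝ, 0 < ε → ∀ m : ℝ,
      (∀ᵐ x ∂μ.restrict (Metric.cthickening ε K), m ≤ h x) →
      Quantization.essSupOn μ h (Metric.cthickening ε K) ≠ ∞ → ∃ M : ℝ, m ≤ M ∧
      Quantization.essSupOn μ h (Metric.cthickening ε K) = ENNReal.ofReal M ∧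
      ∀ᵐ x ∂μ.restrict (Metric.cthickening ε K), h x ≤ M := fun ε hε m hm hfin =>
    Quantization.exists_essSupOn_eq_ofReal
      (Quantization.measure_cthickening_ne_zero hKne hε) hm hfin
  refine ⟨?_, ?_, ?_, ?_⟩
  · refine Quantization.le_ofReal_mul_iInf_rpow (by positivity) (by positivity) fun ε hε => ?_
    obtain ⟨m, hm0, -, hmh, N, hN1, hN⟩ := key ε hε
    by_cases hfinite : Quantization.essSupOn μ h (Metric.cthickening ε K) = ∞
    · rw [hfinite, ENNReal.top_rpow_of_pos (by positivity), ENNReal.mul_top]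
      · exact le_top
      · rw [Ne, ENNReal.ofReal_eq_zero, not_le]
        positivity
    obtain ⟨M, hmM, hM, hMh⟩ := hsup ε hε m hmh hfinite
    have hM0 := hm0.trans_le hmM
    rw [hM, ENNReal.ofReal_rpow_of_pos hM0, ← ENNReal.ofReal_mul (by positivity)]
    refine Quantization.limsup_mul_biSup_le (N := N) fun n hn a ha => ?_
    obtain ⟨h1, h2, -, -⟩ := hN n hn a ha
    exact Quantization.natCast_mul_measure_cell_le hd hr hc hP (hN1.trans hn) hM0
      (ae_restrict_of_ae_restrict_of_subset h1 hMh) h2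
  · refine Quantization.le_mul_one_add_log_iInf (by positivity) fun ε hε hfinite => ?_
    obtain ⟨m, hm0, hm, hmh, N, hN1, hN⟩ := key ε hε
    -- The essential infimum is finite, so a finite ratio forces a finite essential supremum.
    have hsup_ne : Quantization.essSupOn μ h (Metric.cthickening ε K) ≠ ∞ := by
      intro htop
      rw [htop, hm, ENNReal.top_div_of_ne_top ENNReal.ofReal_ne_top] at hfinite
      exact hfinite rfl
    obtain ⟨M, hmM, hM, hMh⟩ := hsup ε hε m hmh hsup_ne
    refine ⟨M / m, (one_le_div hm0).2 hmM, by rw [hM, hm, ENNReal.ofReal_div_of_pos hm0], ?_⟩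
    refine Quantization.limsup_mul_biSup_le (N := N) fun n hn a ha => ?_
    obtain ⟨h1, h2, h3, -⟩ := hN n hn a ha
    exact Quantization.natCast_rpow_mul_localInertia_le hd hr hc h_meas hP (hN1.trans hn) hm0 hmM
      (ae_restrict_of_ae_restrict_of_subset h1 hMh) h2 h3
  · simp_rw [ENNReal.mul_iSup]
    refine iSup₂_le fun ε hε => ?_
    obtain ⟨m, hm0, hm, -, N, hN1, hN⟩ := key ε hε
    rw [hm, ENNReal.ofReal_rpow_of_pos hm0, ← ENNReal.ofReal_mul hD0.le]
    refine Quantization.le_liminf_mul_biInf (N := N) (fun n hn => ?_) fun n hn a ha =>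
      (hN n hn a ha).2.2.2
    have := hN1.trans hn
    exact ⟨by simp; omega, ENNReal.natCast_ne_top n⟩
  · simp_rw [ENNReal.mul_iSup]
    refine iSup₂_le fun ε hε => ?_
    obtain ⟨m, hm0, hm, hmh, N, hN1, hN⟩ := key ε hε
    have hmax : 0 < max 1 r := hr.trans_le (le_max_right _ _)
    by_cases hfinite : Quantization.essSupOn μ h (Metric.cthickening ε K) = ∞
    · rw [hfinite, ENNReal.div_top, ENNReal.zero_rpow_of_pos hmax, mul_zero]
      exact bot_le
    obtain ⟨M, hmM, hM, hMh⟩ := hsup ε hε m hmh hfinite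
    have hM0 := hm0.trans_le hmM
    rw [hM, hm, ← ENNReal.ofReal_div_of_pos hM0, ENNReal.ofReal_rpow_of_pos (by positivity),
      ← ENNReal.ofReal_mul (by positivity)]
    refine Quantization.le_liminf_mul_biInf (N := N) (fun n hn => ?_) fun n hn a ha => ?_
    · rw [Quantization.natCast_rpow_eq_ofReal (hN1.trans hn)]
      have hn0 : (0 : ℝ) < n := by exact_mod_cast hN1.trans hn
      refine ⟨?_, ENNReal.ofReal_ne_top⟩
      rw [Ne, ENNReal.ofReal_eq_zero, not_le]
      positivity
    · obtain ⟨h1, -, -, h4⟩ := hN n hn a ha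
      exact Quantization.le_natCast_rpow_mul_localInertia hd hr h_meas hP (hN1.trans hn) hm0 hmM
        (ae_restrict_of_ae_restrict_of_subset h1 hMh) hD0
        (h4.trans (mul_le_mul_right (measure_mono (Quantization.openCell_subset_cell ha.1)) _))
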